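/- Let $E$ be a real Banach lattice that is an AM-space, i.e. $\|x\vee y\|=\max\{\|x\|,\|y\|\}$ for all $x,y\ge 0$ in $E$, let $X$ be an arbitrary real Banach space, and let $T:E\to X$ be a continuous linear operator. Then $T$ is uaw-Dunford–Pettis if and only if $T$ is Dunford–Pettis. Here $T$ is called Dunford–Pettis if $\|Tx_n\|\to 0$ for every sequence $(x_n)$ in $E$ that converges weakly to $0$. A sequence $(x_n)$ in $E$ is uaw-convergent to $0$ (unbounded absolutely weakly null) if $|x_n|\wedge u\to 0$ weakly for every $u\in E$ with $u\ge 0$, and $T$ is called uaw-Dunford–Pettis (unbounded absolute weak Dunford–Pettis) if $\|Tx_n\|\to 0$ for every norm bounded sequence $(x_n)$ in $E$ that is uaw-convergent to $0$. -/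

import Mathlib

open Filter Topology

/-- The family `x` converges weakly to `a` along `l`, i.e. it converges in the weak topology
`σ(E, E')` of the real normed space `E`. -/
def WeakTendsto {ι E : Type*} [NormedAddCommGroup E] [NormedSpace ℝ E]
    (x : ι → E) (l : Filter ι) (a : E) : Prop :=
  Tendsto (fun i => toWeakSpace ℝ E (x i)) l (𝓝 (toWeakSpace ℝ E a))

/-- Weak convergence is convergence against every bounded linear functional. -/
theorem weakTendsto_iff {ι E : Type*} [NormedAddCommGroup E] [NormedSpace ℝ E]
    (x : ι → E) (l : Filter ι) (a : E) :
    WeakTendsto x l a ↔ ∀ f : E →L[ℝ] ℝ, Tendsto (fun i => f (x i)) l (𝓝 (f a)) :=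
  WeakBilin.tendsto_iff_forall_eval_tendsto (topDualPairing ℝ E).flip
    (fun _ _ h => (SeparatingDual.eq_iff_forall_dual_eq (R := ℝ)).2 fun g => LinearMap.congr_fun h g)

/-- Unbounded absolute weak convergence `x_i → a` along `l`: for every `u ≥ 0` in `E`,
`|x_i - a| ∧ u → 0` weakly. -/
def UawTendsto {ι E : Type*} [NormedAddCommGroup E] [NormedSpace ℝ E] [Lattice E]
    (x : ι → E) (l : Filter ι) (a : E) : Prop :=
  ∀ u : E, 0 ≤ u → WeakTendsto (fun i => |x i - a| ⊓ u) l 0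

/-- The continuous operator `T` is Dunford-Pettis: it maps weakly null sequences to norm null
sequences. -/
def IsDunfordPettis {E X : Type*} [NormedAddCommGroup E] [NormedSpace ℝ E]
    [NormedAddCommGroup X] [NormedSpace ℝ X] (T : E →L[ℝ] X) : Prop :=
  ∀ x : ℕ → E, WeakTendsto x atTop 0 → Tendsto (fun n => ‖T (x n)‖) atTop (𝓝 0)

/-- The continuous operator `T` is unbounded absolute weak Dunford-Pettis: it maps norm bounded
uaw-null sequences to norm null sequences. -/
def IsUawDunfordPettis {E X : Type*} [NormedAddCommGroup E] [NormedSpace ℝ E] [Lattice E]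
    [NormedAddCommGroup X] [NormedSpace ℝ X] (T : E →L[ℝ] X) : Prop :=
  ∀ x : ℕ → E, (∃ C : ℝ, ∀ n, ‖x n‖ ≤ C) → UawTendsto x atTop 0 →
    Tendsto (fun n => ‖T (x n)‖) atTop (𝓝 0)

/-- The norm of `E` is an M-norm: `‖x ∨ y‖ = max ‖x‖ ‖y‖` for all `x, y ≥ 0`.
A Banach lattice with this property is an AM-space. -/
def IsAMSpace (E : Type*) [NormedAddCommGroup E] [Lattice E] : Prop :=
  ∀ x y : E, 0 ≤ x → 0 ≤ y → ‖x ⊔ y‖ = max ‖x‖ ‖y‖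

/-! In an AM-space a norm bounded sequence is uaw-null if and only if it is weakly null, so that
both properties of `T` speak about the same sequences.

Write `|g|` for the modulus of a bounded functional `g`, which is additive, monotone and bounded on
the positive cone (`functionalModulus`), and say that a sequence `v` has property (S) if there is
`δ > 0` such that every finite family `v₀, …, vₙ` dominates a positive `W` with `‖W‖ ≥ δ`. Two facts
carry the argument.

* *Selection* (`IsAMSpace.exists_selection`): if `w` is positive, bounded and `|g| (w n) ≥ ε > 0`
  for all `n`, then there are indices `j k ≥ k` such that `w ∘ j` has property (S). Since suprema
  preserve norm bounds in an AM-space, blocks `Y k = w k ⊔ ⋯ ⊔ w (k + m k)` can be chosen that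
  nearly exhaust `|g|` on the tails, and then `|g| (Y 0 ⊓ ⋯ ⊓ Y n) ≥ ε / 2` for all `n`. This
  plays the part of the reverse Fatou lemma. By distributivity `Y 0 ⊓ ⋯ ⊓ Y n` is a supremum of
  infima `w (j 0) ⊓ ⋯ ⊓ w (j n)`, so its norm is the largest of their norms, and the `j k` can be
  chosen one after another as in König's lemma.
* *Mazur* (`not_weakTendsto_of_le_posPart`): if the positive parts of `v` have property (S), then
  `v` is not weakly null. Indeed a positive `W` below `c⁺` and `d⁺` is below the positive part of
  every convex combination of `c` and `d`, so the convex hull of `v` stays at distance `δ` from `0`.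

If `x` is weakly null, this gives `|g| (x n)⁺ → 0`, likewise `|g| (x n)⁻ → 0`, hence
`|g| |x n| → 0`, which makes `|x n| ⊓ u` weakly null. If `x` is bounded and uaw-null but `|g| |x n|`
does not tend to `0`, selection gives a sequence `|x (j k)|` with property (S); then
`|x (j k)| ⊓ |x (j 0)|` has it too, although it is weakly null. -/

/-! ### Lattice-ordered groups and vector spaces -/

section Lattice

variable {E : Type*} [AddCommGroup E] [Lattice E] [IsOrderedAddMonoid E]

theorem inf_add_le_inf_add_inf {a b c : E} (ha : 0 ≤ a) (hb : 0 ≤ b) (hc : 0 ≤ c) :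
    a ⊓ (b + c) ≤ a ⊓ b + a ⊓ c := by
  rw [inf_add, add_inf, add_inf]
  refine le_inf (le_inf ?_ ?_) (le_inf ?_ inf_le_right)
  · exact inf_le_left.trans (le_add_of_nonneg_left ha)
  · exact inf_le_left.trans (le_add_of_nonneg_right hc)
  · exact inf_le_left.trans (le_add_of_nonneg_left hb)

/-- The Riesz decomposition property, for elements of arbitrary sign. -/
theorem exists_add_eq_of_abs_le_add {x y c : E} (hx : 0 ≤ x) (hy : 0 ≤ y) (hc : |c| ≤ x + y) :
    ∃ a b : E, |a| ≤ x ∧ |b| ≤ y ∧ a + b = c := by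
  obtain ⟨h1, h2⟩ := abs_le'.1 hc
  refine ⟨(c ⊓ x) ⊔ -x, c - ((c ⊓ x) ⊔ -x), abs_le'.2 ⟨?_, ?_⟩, ?_, by abel⟩
  · exact sup_le inf_le_right (neg_le_self hx)
  · exact neg_le.1 le_sup_right
  · rw [sub_sup, sub_inf, sub_self, abs_le']
    constructor
    · refine inf_le_left.trans (sup_le hy ?_)
      rwa [sub_le_iff_le_add, add_comm]
    · rw [neg_le]
      refine le_inf ((neg_nonpos.2 hy).trans le_sup_left) ?_
      rw [sub_neg_eq_add, neg_le_iff_add_nonneg]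
      have := add_le_add_left h2 c
      rw [neg_add_cancel] at this
      exact this.trans_eq (by abel)

/-- Below the positive part of each of two vectors means below the positive part of their convex
combinations: cancellation with negative parts cannot occur on a common lower bound. -/
theorem le_posPart_convexCombination [Module ℝ E] [IsOrderedModule ℝ E] {W c d : E} (hW : 0 ≤ W)
    (hc : W ≤ c⁺) (hd : W ≤ d⁺) {s t : ℝ} (hs : 0 ≤ s) (ht : 0 ≤ t) (hst : s + t = 1) :
    W ≤ (s • c + t • d)⁺ := by
  have disj : ∀ {c : E}, W ≤ c⁺ → W ⊓ c⁻ ≤ 0 := fun {c} h =>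
    (inf_le_inf_right _ h).trans_eq (posPart_inf_negPart_eq_zero c)
  have scale : ∀ {r : ℝ} (c : E), r ≤ 1 → r • c⁻ ≤ c⁻ := fun c hr => by
    simpa using smul_le_smul_of_nonneg_right hr (negPart_nonneg c)
  have hq : W ⊓ (s • c⁻ + t • d⁻) ≤ 0 := by
    refine (inf_le_inf_left W (add_le_add (scale c (by linarith)) (scale d (by linarith)))).trans ?_
    refine (inf_add_le_inf_add_inf hW (negPart_nonneg c) (negPart_nonneg d)).trans ?_
    exact add_nonpos (disj hc) (disj hd)
  have hp : W ≤ s • c⁺ + t • d⁺ := by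
    calc W = s • W + t • W := by rw [← add_smul, hst, one_smul]
      _ ≤ _ := add_le_add (smul_le_smul_of_nonneg_left hc hs) (smul_le_smul_of_nonneg_left hd ht)
  calc W ≤ W - W ⊓ (s • c⁻ + t • d⁻) := by rwa [le_sub_self_iff]
    _ = 0 ⊔ (W - (s • c⁻ + t • d⁻)) := by rw [sub_inf, sub_self]
    _ ≤ 0 ⊔ (s • c⁺ + t • d⁺ - (s • c⁻ + t • d⁻)) := sup_le_sup_left (sub_le_sub_right hp _) _
    _ = (s • c + t • d)⁺ := by
      rw [sup_comm, ← posPart_def, add_sub_add_comm, ← smul_sub, ← smul_sub,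
        posPart_sub_negPart, posPart_sub_negPart]

end Lattice

/-! ### The modulus of a functional on the positive cone -/

section NormedLattice

variable {E : Type*} [NormedAddCommGroup E] [Lattice E] [IsOrderedAddMonoid E] [HasSolidNorm E]
  [NormedSpace ℝ E]

/-- The modulus `|g|` of a bounded functional, `|g| x = sup {g y : |y| ≤ x}`. It is meaningful on
the positive cone only; for other `x` the set may be empty and the value is arbitrary. -/
noncomputable def functionalModulus (g : E →L[ℝ] ℝ) (x : E) : ℝ :=
  sSup (g '' {y | |y| ≤ x})

theorem apply_le_norm_mul_of_abs_le {E : Type*} [NormedAddCommGroup E] [Lattice E]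
    [HasSolidNorm E] [NormedSpace ℝ E] (g : E →L[ℝ] ℝ) {x y : E} (h : |y| ≤ x) :
    g y ≤ ‖g‖ * ‖x‖ := by
  refine (le_abs_self _).trans ((g.le_opNorm y).trans ?_)
  refine mul_le_mul_of_nonneg_left (norm_le_norm_of_abs_le_abs (h.trans (le_abs_self x))) ?_
  exact norm_nonneg g

theorem apply_le_functionalModulus {E : Type*} [NormedAddCommGroup E] [Lattice E]
    [HasSolidNorm E] [NormedSpace ℝ E] (g : E →L[ℝ] ℝ) {x y : E} (h : |y| ≤ x) :
    g y ≤ functionalModulus g x :=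
  le_csSup ⟨‖g‖ * ‖x‖, by rintro _ ⟨y, hy, rfl⟩; exact apply_le_norm_mul_of_abs_le g hy⟩
    ⟨y, h, rfl⟩

theorem functionalModulus_le {E : Type*} [NormedAddCommGroup E] [Lattice E]
    [IsOrderedAddMonoid E] [NormedSpace ℝ E] (g : E →L[ℝ] ℝ) {x : E} (hx : 0 ≤ x) {M : ℝ}
    (h : ∀ y, |y| ≤ x → g y ≤ M) : functionalModulus g x ≤ M :=
  csSup_le ⟨g 0, 0, by simpa using hx, rfl⟩ (by rintro _ ⟨y, hy, rfl⟩; exact h y hy)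

theorem functionalModulus_nonneg (g : E →L[ℝ] ℝ) {x : E} (hx : 0 ≤ x) :
    0 ≤ functionalModulus g x := by
  simpa using apply_le_functionalModulus g (x := x) (y := 0) (by simpa using hx)

theorem functionalModulus_le_norm (g : E →L[ℝ] ℝ) {x : E} (hx : 0 ≤ x) :
    functionalModulus g x ≤ ‖g‖ * ‖x‖ :=
  functionalModulus_le g hx fun _ h => apply_le_norm_mul_of_abs_le g h

theorem functionalModulus_mono (g : E →L[ℝ] ℝ) {x y : E} (hx : 0 ≤ x) (hxy : x ≤ y) :
    functionalModulus g x ≤ functionalModulus g y :=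
  functionalModulus_le g hx fun _ h => apply_le_functionalModulus g (h.trans hxy)

theorem abs_apply_le_functionalModulus {E : Type*} [NormedAddCommGroup E] [Lattice E]
    [HasSolidNorm E] [NormedSpace ℝ E] (g : E →L[ℝ] ℝ) (x : E) :
    |g x| ≤ functionalModulus g |x| := by
  refine abs_le'.2 ⟨apply_le_functionalModulus g le_rfl, ?_⟩
  rw [← map_neg]
  exact apply_le_functionalModulus g (abs_neg x).le

theorem functionalModulus_add (g : E →L[ℝ] ℝ) {x y : E} (hx : 0 ≤ x) (hy : 0 ≤ y) :
    functionalModulus g (x + y) = functionalModulus g x + functionalModulus g y := by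
  apply le_antisymm
  · refine functionalModulus_le g (add_nonneg hx hy) fun c hc => ?_
    obtain ⟨a, b, ha, hb, rfl⟩ := exists_add_eq_of_abs_le_add hx hy hc
    rw [map_add]
    exact add_le_add (apply_le_functionalModulus g ha) (apply_le_functionalModulus g hb)
  · rw [← le_sub_iff_add_le]
    refine functionalModulus_le g hx fun a ha => ?_
    rw [le_sub_comm]
    refine functionalModulus_le g hy fun b hb => ?_
    rw [le_sub_iff_add_le', ← map_add]
    exact apply_le_functionalModulus g ((abs_add_le a b).trans (add_le_add ha hb))

theorem functionalModulus_inf_add_sup (g : E →L[ℝ] ℝ) {x y : E} (hx : 0 ≤ x) (hy : 0 ≤ y) :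
    functionalModulus g (x ⊓ y) + functionalModulus g (x ⊔ y) =
      functionalModulus g x + functionalModulus g y := by
  rw [← functionalModulus_add g (le_inf hx hy) (hx.trans le_sup_left), inf_add_sup,
    functionalModulus_add g hx hy]

end NormedLattice

/-! ### Partial suprema in AM-spaces and the selection of indices -/

section AMSpace

variable {E : Type*} [NormedAddCommGroup E] [Lattice E]

theorem partialSups_nonneg [IsOrderedAddMonoid E] {v : ℕ → E} (hv : ∀ i, 0 ≤ v i) (m : ℕ) :
    0 ≤ partialSups v m :=
  (hv 0).trans (le_partialSups_of_le v (Nat.zero_le m))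

theorem IsAMSpace.norm_partialSups_le [IsOrderedAddMonoid E] (hE : IsAMSpace E) {v : ℕ → E}
    (hv : ∀ i, 0 ≤ v i) {B : ℝ} (hB : ∀ i, ‖v i‖ ≤ B) (m : ℕ) : ‖partialSups v m‖ ≤ B := by
  induction m with
  | zero => simpa using hB 0
  | succ m ih =>
    rw [partialSups_add_one, hE _ _ (partialSups_nonneg hv m) (hv _)]
    exact max_le ih (hB _)

/-- In an AM-space, a positive vector below a finite supremum keeps its norm when truncated by a
suitable member of the family. -/
theorem IsAMSpace.exists_norm_le_inf [IsOrderedAddMonoid E] (hE : IsAMSpace E) {v : ℕ → E}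
    (hv : ∀ i, 0 ≤ v i) (m : ℕ) {U : E} (hU : 0 ≤ U) (h : U ≤ partialSups v m) :
    ∃ i ≤ m, ‖U‖ ≤ ‖U ⊓ v i‖ := by
  induction m generalizing U with
  | zero => exact ⟨0, le_rfl, by rw [inf_eq_left.2 (by simpa using h)]⟩
  | succ m ih =>
    let : DistribLattice E := AddCommGroup.toDistribLattice E
    have hP := partialSups_nonneg hv m
    have key : ‖U‖ = max ‖U ⊓ partialSups v m‖ ‖U ⊓ v (m + 1)‖ := by
      rw [← hE _ _ (le_inf hU hP) (le_inf hU (hv _)), ← inf_sup_left, ← partialSups_add_one,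
        inf_eq_left.2 h]
    rcases max_choice ‖U ⊓ partialSups v m‖ ‖U ⊓ v (m + 1)‖ with h' | h'
    · obtain ⟨i, hi, hle⟩ := ih (le_inf hU hP) inf_le_right
      refine ⟨i, hi.trans (Nat.le_succ m), ?_⟩
      rw [inf_assoc, inf_eq_right.2 (le_partialSups_of_le v hi)] at hle
      exact (key.trans h').le.trans hle
    · exact ⟨m + 1, le_rfl, (key.trans h').le⟩

/-- The blocks `w k ⊔ ⋯ ⊔ w (k + m k)` can be chosen so long that all their finite infima are
uniformly large in norm. -/
theorem IsAMSpace.exists_blocks [NormedSpace ℝ E] [IsOrderedAddMonoid E] [HasSolidNorm E]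
    (hE : IsAMSpace E) (g : E →L[ℝ] ℝ) {w : ℕ → E} (hw : ∀ n, 0 ≤ w n) {B : ℝ}
    (hB : ∀ n, ‖w n‖ ≤ B) {ε : ℝ} (hε : 0 < ε) (hge : ∀ n, ε ≤ functionalModulus g (w n)) :
    ∃ m : ℕ → ℕ, ∃ δ : ℝ, 0 < δ ∧ ∀ n, ∃ Z : E, 0 ≤ Z ∧ δ ≤ ‖Z‖ ∧
      ∀ k ≤ n, Z ≤ partialSups (fun i => w (k + i)) (m k) := by
  set Y : ℕ → ℕ → E := fun k m => partialSups (fun i => w (k + i)) m with hY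
  have hYnn : ∀ k m, 0 ≤ Y k m := fun k m => partialSups_nonneg (fun i => hw (k + i)) m
  have hYB : ∀ k m, ‖Y k m‖ ≤ B := fun k m =>
    hE.norm_partialSups_le (fun i => hw (k + i)) (fun i => hB (k + i)) m
  have hYmono : ∀ k, Monotone (Y k) := fun k => (partialSups fun i => w (k + i)).monotone
  have hYsucc : ∀ k m, Y (k + 1) m ≤ Y k (m + 1) := fun k m => by
    refine partialSups_le _ _ _ fun i hi => ?_
    rw [show k + 1 + i = k + (i + 1) by ring]
    exact le_partialSups_of_le (fun i => w (k + i)) (Nat.succ_le_succ hi)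
  -- `s k` is the value of `|g|` on the (not necessarily existing) supremum of the tail from `k`.
  set s : ℕ → ℝ := fun k => ⨆ m, functionalModulus g (Y k m) with hs
  have hbdd : ∀ k, BddAbove (Set.range fun m => functionalModulus g (Y k m)) := fun k => by
    refine ⟨‖g‖ * B, ?_⟩
    rintro _ ⟨m, rfl⟩
    exact (functionalModulus_le_norm g (hYnn k m)).trans
      (mul_le_mul_of_nonneg_left (hYB k m) (norm_nonneg g))
  have hle : ∀ k m, functionalModulus g (Y k m) ≤ s k := fun k m => le_ciSup (hbdd k) m
  have hsε : ∀ k, ε ≤ s k := fun k => (hge k).trans (by simpa [hY] using hle k 0)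
  -- The errors `ε / 2 ^ (k + 2)` sum up to less than `ε / 2`.
  have hex : ∀ k : ℕ, ∃ m, s k - ε / 2 ^ (k + 2) < functionalModulus g (Y k m) := fun k =>
    exists_lt_of_lt_ciSup (sub_lt_self _ (by positivity))
  choose m hm using hex
  have main : ∀ n, ∃ Z : E, 0 ≤ Z ∧ (∀ k ≤ n, Z ≤ Y k (m k)) ∧
      s n - ε / 2 + ε / 2 ^ (n + 2) ≤ functionalModulus g Z := by
    intro n
    induction n with
    | zero =>
      refine ⟨Y 0 (m 0), hYnn _ _, fun k hk => by rw [Nat.le_zero.1 hk], ?_⟩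
      have := hm 0
      norm_num at this ⊢
      linarith
    | succ n ih =>
      obtain ⟨Z, hZ, hZle, hZs⟩ := ih
      refine ⟨Z ⊓ Y (n + 1) (m (n + 1)), le_inf hZ (hYnn _ _), fun k hk => ?_, ?_⟩
      · rcases Nat.le_succ_iff.1 hk with hk | rfl
        · exact inf_le_left.trans (hZle k hk)
        · exact inf_le_right
      · have hmod := functionalModulus_inf_add_sup g hZ (hYnn (n + 1) (m (n + 1)))
        -- Both `Z` and the new block lie below a long block starting at `n`.
        have hsup : functionalModulus g (Z ⊔ Y (n + 1) (m (n + 1))) ≤ s n := by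
          refine (functionalModulus_mono g (hZ.trans le_sup_left) (sup_le ?_ ?_)).trans
            (hle n (max (m n) (m (n + 1) + 1)))
          · exact (hZle n le_rfl).trans (hYmono n (le_max_left _ _))
          · exact (hYsucc n _).trans (hYmono n (le_max_right _ _))
        have hnew := hm (n + 1)
        have hpow : ε / 2 ^ (n + 2) = ε / 2 ^ (n + 1 + 2) + ε / 2 ^ (n + 1 + 2) := by
          rw [show n + 1 + 2 = (n + 2) + 1 by ring, pow_succ]
          field_simp
          ring
        linarith
  refine ⟨m, ε / 2 / (‖g‖ + 1), by positivity, fun n => ?_⟩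
  obtain ⟨Z, hZ, hZle, hZs⟩ := main n
  refine ⟨Z, hZ, ?_, hZle⟩
  rw [div_le_iff₀ (by positivity)]
  have h1 := functionalModulus_le_norm g hZ
  have h2 := hsε n
  have h3 : 0 < ε / 2 ^ (n + 2) := by positivity
  nlinarith [norm_nonneg Z]

theorem IsAMSpace.exists_selection [NormedSpace ℝ E] [IsOrderedAddMonoid E] [HasSolidNorm E]
    (hE : IsAMSpace E) (g : E →L[ℝ] ℝ) {w : ℕ → E} (hw : ∀ n, 0 ≤ w n) {B : ℝ}
    (hB : ∀ n, ‖w n‖ ≤ B) {ε : ℝ} (hε : 0 < ε) (hge : ∀ n, ε ≤ functionalModulus g (w n)) :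
    ∃ j : ℕ → ℕ, (∀ k, k ≤ j k) ∧ ∃ δ : ℝ, 0 < δ ∧ ∀ n, ∃ W : E, 0 ≤ W ∧ δ ≤ ‖W‖ ∧
      ∀ k ≤ n, W ≤ w (j k) := by
  obtain ⟨m, δ, hδ, hblocks⟩ := hE.exists_blocks g hw hB hε hge
  set Y : ℕ → E := fun k => partialSups (fun i => w (k + i)) (m k) with hY
  -- `Good n V` says that `V` still meets all blocks with index at least `n` in norm `δ`.
  let Good : ℕ → E → Prop := fun n V =>
    ∀ N, ∃ U, 0 ≤ U ∧ U ≤ V ∧ δ ≤ ‖U‖ ∧ ∀ k, n ≤ k → k ≤ N → U ≤ Y k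
  have step : ∀ n V, Good n V → ∃ j, n ≤ j ∧ Good (n + 1) (V ⊓ w j) := by
    intro n V hV
    by_contra! hcon
    have hbad : ∀ i, ∃ N, ∀ U, 0 ≤ U → U ≤ V ⊓ w (n + i) → δ ≤ ‖U‖ →
        ¬ ∀ k, n + 1 ≤ k → k ≤ N → U ≤ Y k := fun i => by
      have := hcon (n + i) (Nat.le_add_right _ _)
      simp only [Good, not_forall] at this
      obtain ⟨N, hN⟩ := this
      exact ⟨N, fun U h1 h2 h3 h4 => hN ⟨U, h1, h2, h3, h4⟩⟩
    choose N hN using hbad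
    obtain ⟨U, hU, hUV, hUδ, hUY⟩ := hV (n + (Finset.range (m n + 1)).sup N)
    obtain ⟨i, hi, hle⟩ := hE.exists_norm_le_inf (fun i => hw (n + i)) (m n) hU
      (hUY n le_rfl (Nat.le_add_right _ _))
    refine hN i (U ⊓ w (n + i)) (le_inf hU (hw _)) (inf_le_inf_right _ hUV) (hUδ.trans hle) ?_
    intro k hk hkN
    refine inf_le_left.trans (hUY k (by omega) (hkN.trans ?_))
    have : N i ≤ (Finset.range (m n + 1)).sup N :=
      Finset.le_sup (f := N) (Finset.mem_range.2 (Nat.lt_succ_of_le hi))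
    omega
  choose! c hc hgood using step
  -- The first block serves as a starting value in place of a largest element.
  let V : ℕ → E := fun n => Nat.rec (Y 0) (fun n v => v ⊓ w (c n v)) n
  have hVsucc : ∀ n, V (n + 1) = V n ⊓ w (c n (V n)) := fun n => rfl
  have hV : ∀ n, Good n (V n) := by
    intro n
    induction n with
    | zero =>
      intro N
      obtain ⟨Z, hZ, hZδ, hZle⟩ := hblocks N
      exact ⟨Z, hZ, hZle 0 (Nat.zero_le N), hZδ, fun k _ hk => hZle k hk⟩
    | succ n ih => exact hgood n _ ih
  have hanti : Antitone V := antitone_nat_of_succ_le fun n => (hVsucc n).trans_le inf_le_left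
  refine ⟨fun n => c n (V n), fun n => hc n _ (hV n), δ, hδ, fun n => ?_⟩
  obtain ⟨U, hU, hUV, hUδ, -⟩ := hV (n + 1) 0
  refine ⟨U, hU, hUδ, fun k hk => hUV.trans ((hanti (Nat.succ_le_succ hk)).trans ?_)⟩
  exact (hVsucc k).trans_le inf_le_right

end AMSpace

/-! ### Weakly null and uaw-null sequences -/

theorem WeakTendsto.zero_mem_closure_convexHull {E : Type*} [NormedAddCommGroup E]
    [NormedSpace ℝ E] {v : ℕ → E} (h : WeakTendsto v atTop 0) :
    (0 : E) ∈ closure (convexHull ℝ (Set.range v)) := by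
  have hmem : toWeakSpace ℝ E 0 ∈ closure (toWeakSpace ℝ E '' convexHull ℝ (Set.range v)) :=
    mem_closure_of_tendsto h (Eventually.of_forall fun n =>
      ⟨v n, subset_convexHull ℝ _ ⟨n, rfl⟩, rfl⟩)
  rw [← (convex_convexHull ℝ (Set.range v)).toWeakSpace_closure ℝ] at hmem
  obtain ⟨y, hy, hy0⟩ := hmem
  rwa [(toWeakSpace ℝ E).injective hy0] at hy

theorem WeakTendsto.exists_norm_le {E : Type*} [NormedAddCommGroup E] [NormedSpace ℝ E]
    {v : ℕ → E} {a : E} (h : WeakTendsto v atTop a) : ∃ C : ℝ, ∀ n, ‖v n‖ ≤ C := by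
  rw [weakTendsto_iff] at h
  obtain ⟨C, hC⟩ := banach_steinhaus
    (g := fun n => NormedSpace.inclusionInDoubleDual ℝ E (v n)) fun f => by
      obtain ⟨C, hC⟩ := ((h f).norm).bddAbove_range
      exact ⟨C, fun n => hC ⟨n, rfl⟩⟩
  refine ⟨C, fun n => ?_⟩
  have := hC n
  rwa [← (NormedSpace.inclusionInDoubleDualLi ℝ (E := E)).norm_map (v n)]

theorem WeakTendsto.comp {E : Type*} [NormedAddCommGroup E] [NormedSpace ℝ E]
    {v : ℕ → E} {a : E} (h : WeakTendsto v atTop a) {j : ℕ → ℕ} (hj : Tendsto j atTop atTop) :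
    WeakTendsto (fun n => v (j n)) atTop a :=
  Tendsto.comp (g := fun n => toWeakSpace ℝ E (v n)) h hj

theorem WeakTendsto.neg_zero {E : Type*} [NormedAddCommGroup E] [NormedSpace ℝ E]
    {v : ℕ → E} (h : WeakTendsto v atTop 0) : WeakTendsto (fun n => -v n) atTop 0 := by
  rw [weakTendsto_iff] at h ⊢
  intro f
  simpa using (h f).neg

section BanachLattice

variable {E : Type*} [NormedAddCommGroup E] [NormedSpace ℝ E] [Lattice E] [IsOrderedAddMonoid E]
  [HasSolidNorm E]

theorem not_weakTendsto_of_le_posPart [IsOrderedModule ℝ E] {v : ℕ → E} {δ : ℝ} (hδ : 0 < δ)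
    (hv : ∀ n, ∃ W : E, 0 ≤ W ∧ δ ≤ ‖W‖ ∧ ∀ k ≤ n, W ≤ (v k)⁺) : ¬ WeakTendsto v atTop 0 := by
  intro h
  obtain ⟨c, hc, hcδ⟩ := Metric.mem_closure_iff.1 h.zero_mem_closure_convexHull δ hδ
  rw [dist_zero_left] at hcδ
  have hsub : convexHull ℝ (Set.range v) ⊆
      {c | ∃ n, ∀ W : E, 0 ≤ W → (∀ k ≤ n, W ≤ (v k)⁺) → W ≤ c⁺} := by
    refine convexHull_min ?_ ?_
    · rintro _ ⟨n, rfl⟩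
      exact ⟨n, fun W _ hW => hW n le_rfl⟩
    · rintro c ⟨n, hn⟩ d ⟨n', hn'⟩ s t hs ht hst
      refine ⟨max n n', fun W hW hk => le_posPart_convexCombination hW ?_ ?_ hs ht hst⟩
      · exact hn W hW fun k h => hk k (h.trans (le_max_left _ _))
      · exact hn' W hW fun k h => hk k (h.trans (le_max_right _ _))
  obtain ⟨n, hn⟩ := hsub hc
  obtain ⟨W, hW, hWδ, hWle⟩ := hv n
  have hWc : ‖W‖ ≤ ‖c‖ := by
    apply norm_le_norm_of_abs_le_abs
    rw [abs_of_nonneg hW]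
    exact (hn W hW hWle).trans (sup_le (le_abs_self c) (abs_nonneg c))
  linarith

/-- If the moduli `|g| (w n)` do not tend to `0`, then they stay away from `0` on a subsequence,
to which the selection applies. -/
theorem IsAMSpace.exists_selection_of_not_tendsto (hE : IsAMSpace E) (g : E →L[ℝ] ℝ) {w : ℕ → E}
    (hw : ∀ n, 0 ≤ w n) {B : ℝ} (hB : ∀ n, ‖w n‖ ≤ B)
    (h : ¬ Tendsto (fun n => functionalModulus g (w n)) atTop (𝓝 0)) :
    ∃ j : ℕ → ℕ, Tendsto j atTop atTop ∧ ∃ δ : ℝ, 0 < δ ∧ ∀ n, ∃ W : E, 0 ≤ W ∧ δ ≤ ‖W‖ ∧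
      ∀ k ≤ n, W ≤ w (j k) := by
  rw [Metric.tendsto_nhds] at h
  push Not at h
  obtain ⟨ε, hε, hfreq⟩ := h
  obtain ⟨φ, hφ, hφε⟩ := extraction_of_frequently_atTop hfreq
  have hge : ∀ n, ε ≤ functionalModulus g (w (φ n)) := fun n => by
    have := hφε n
    rwa [Real.dist_0_eq_abs, abs_of_nonneg (functionalModulus_nonneg g (hw _))] at this
  obtain ⟨j, hj, δ, hδ, hW⟩ := hE.exists_selection g (fun n => hw (φ n)) (fun n => hB (φ n)) hε hge
  exact ⟨fun k => φ (j k), hφ.tendsto_atTop.comp (tendsto_atTop_mono hj tendsto_id), δ, hδ, hW⟩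

theorem WeakTendsto.tendsto_functionalModulus_posPart [IsOrderedModule ℝ E] (hE : IsAMSpace E)
    {x : ℕ → E} (hx : WeakTendsto x atTop 0) (g : E →L[ℝ] ℝ) :
    Tendsto (fun n => functionalModulus g (x n)⁺) atTop (𝓝 0) := by
  by_contra h
  obtain ⟨B, hB⟩ := hx.exists_norm_le
  have hB' : ∀ n, ‖(x n)⁺‖ ≤ B := fun n => by
    refine (norm_le_norm_of_abs_le_abs ?_).trans (hB n)
    rw [abs_of_nonneg (posPart_nonneg _)]
    exact sup_le (le_abs_self _) (abs_nonneg _)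
  obtain ⟨j, hj, δ, hδ, hW⟩ :=
    hE.exists_selection_of_not_tendsto g (fun n => posPart_nonneg (x n)) hB' h
  exact not_weakTendsto_of_le_posPart hδ hW (hx.comp hj)

theorem WeakTendsto.uawTendsto [IsOrderedModule ℝ E] (hE : IsAMSpace E) {x : ℕ → E}
    (hx : WeakTendsto x atTop 0) : UawTendsto x atTop 0 := by
  intro u hu
  rw [weakTendsto_iff]
  intro g
  have hsum := (hx.tendsto_functionalModulus_posPart hE g).add
    (hx.neg_zero.tendsto_functionalModulus_posPart hE g)
  rw [add_zero] at hsum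
  rw [map_zero]
  refine squeeze_zero_norm (fun n => ?_) hsum
  rw [posPart_neg, ← functionalModulus_add g (posPart_nonneg _) (negPart_nonneg _),
    posPart_add_negPart, sub_zero]
  have h0 : 0 ≤ |x n| ⊓ u := le_inf (abs_nonneg _) hu
  refine (abs_apply_le_functionalModulus g _).trans ?_
  rw [abs_of_nonneg h0]
  exact functionalModulus_mono g h0 inf_le_left

theorem UawTendsto.weakTendsto [IsOrderedModule ℝ E] (hE : IsAMSpace E) {x : ℕ → E} {C : ℝ}
    (hC : ∀ n, ‖x n‖ ≤ C) (hx : UawTendsto x atTop 0) : WeakTendsto x atTop 0 := by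
  rw [weakTendsto_iff]
  intro g
  suffices h : Tendsto (fun n => functionalModulus g |x n|) atTop (𝓝 0) by
    rw [map_zero]
    exact squeeze_zero_norm (fun n => abs_apply_le_functionalModulus g (x n)) h
  by_contra h
  obtain ⟨j, hj, δ, hδ, hW⟩ := hE.exists_selection_of_not_tendsto g
    (fun n => abs_nonneg (x n)) (fun n => (norm_abs_eq_norm (x n)).trans_le (hC n)) h
  have hnull := (hx |x (j 0)| (abs_nonneg _)).comp hj
  refine not_weakTendsto_of_le_posPart hδ (fun n => ?_) hnull
  obtain ⟨W, hW0, hWδ, hWle⟩ := hW n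
  refine ⟨W, hW0, hWδ, fun k hk => le_trans ?_ (le_posPart _)⟩
  rw [sub_zero]
  exact le_inf (hWle k hk) (hWle 0 (Nat.zero_le n))

end BanachLattice

/-- Let `E` be a Banach lattice which is an AM-space and `X` a Banach space. A continuous
linear operator `T : E → X` is uaw-Dunford-Pettis if and only if it is Dunford-Pettis. -/
theorem corollary3p7
    {E : Type*} [NormedAddCommGroup E] [NormedSpace ℝ E] [CompleteSpace E]
    [Lattice E] [IsOrderedAddMonoid E] [IsOrderedModule ℝ E] [HasSolidNorm E]
    (hE : IsAMSpace E)
    {X : Type*} [NormedAddCommGroup X] [NormedSpace ℝ X] [CompleteSpace X]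
    (T : E →L[ℝ] X) :
    IsUawDunfordPettis T ↔ IsDunfordPettis T := by
  constructor
  · intro hT x hx
    exact hT x hx.exists_norm_le (hx.uawTendsto hE)
  · rintro hT x ⟨C, hC⟩ hx
    exact hT x (hx.weakTendsto hE hC)
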